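/- **Theorem 3 (Bell class states and the Bell inequality).** Let $\mathcal H$ be a complex Hilbert space, let $\mathcal H\otimes\mathcal H$ and $\mathcal H\otimes\mathcal H\otimes\mathcal H$ be the Hilbert space tensor products, and let a density operator be a positive trace class operator of trace one. Let $\rho$ be a density operator on $\mathcal H\otimes\mathcal H$ of the Bell class, that is, there exists a density operator $T$ on $\mathcal H\otimes\mathcal H\otimes\mathcal H$ such that $$\mathrm{tr}^{(1)}_{\mathcal H}[T]=\mathrm{tr}^{(2)}_{\mathcal H}[T]=\mathrm{tr}^{(3)}_{\mathcal H}[T]=\rho ,$$ where $\mathrm{tr}^{(k)}_{\mathcal H}$ is the partial trace over the $k$-th tensor factor. Then $\rho$ satisfies the perfect correlation form of the original Bell inequality: for all bounded self-adjoint operators $W_1,\widetilde W_1,W_2,\widetilde W_2$ on $\mathcal H$ with operator norms at most $1$, $$\bigl|\mathrm{tr}[\rho(W_1\otimes W_2)]-\mathrm{tr}[\rho(W_1\otimes\widetilde W_2)]\bigr|\le 1-\mathrm{tr}[\rho(W_2\otimes\widetilde W_2)]$$ and $$\bigl|\mathrm{tr}[\rho(W_1\otimes W_2)]-\mathrm{tr}[\rho(\widetilde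 W_1\otimes W_2)]\bigr|\le 1-\mathrm{tr}[\rho(W_1\otimes\widetilde W_1)].$$ No assumption of perfect correlations is made on $\rho$. -/

import Mathlib

open scoped TensorProduct ComplexOrder

noncomputable section

namespace BellClass

universe u v w x

/-- The Hilbert space tensor product of `E` and `F`: the completion of the algebraic tensor
product for the inner product `⟪a ⊗ b, c ⊗ d⟫ = ⟪a, c⟫ * ⟪b, d⟫`. -/
abbrev HilbertTensor (E : Type u) (F : Type v)
    [NormedAddCommGroup E] [InnerProductSpace ℂ E]
    [NormedAddCommGroup F] [InnerProductSpace ℂ F] : Type (max u v) :=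
  UniformSpace.Completion (E ⊗[ℂ] F)

section Tensor

variable {E : Type u} {F : Type v} {E' : Type w} {F' : Type x}
  [NormedAddCommGroup E] [InnerProductSpace ℂ E]
  [NormedAddCommGroup F] [InnerProductSpace ℂ F]
  [NormedAddCommGroup E'] [InnerProductSpace ℂ E']
  [NormedAddCommGroup F'] [InnerProductSpace ℂ F']

/-- The elementary tensor `a ⊗ b` in the Hilbert space tensor product. -/
def tmul (a : E) (b : F) : HilbertTensor E F := ((a ⊗ₜ[ℂ] b : E ⊗[ℂ] F) : HilbertTensor E F)

/-- The tensor product `A ⊗ B` of bounded operators: the continuous extension to the Hilbert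
space tensor product of the map `a ⊗ b ↦ A a ⊗ B b`. -/
def opTensor (A : E →L[ℂ] E') (B : F →L[ℂ] F') :
    HilbertTensor E F →L[ℂ] HilbertTensor E' F' :=
  ((UniformSpace.Completion.toComplL : (E' ⊗[ℂ] F') →L[ℂ] HilbertTensor E' F') ∘L
    TensorProduct.mapL A B).extend
      (UniformSpace.Completion.toComplL : (E ⊗[ℂ] F) →L[ℂ] HilbertTensor E F)

theorem opTensor_tmul (A : E →L[ℂ] E') (B : F →L[ℂ] F') (a : E) (b : F) :
    opTensor A B (tmul a b) = tmul (A a) (B b) :=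
  ContinuousLinearMap.extend_eq _ UniformSpace.Completion.denseRange_coe
    (UniformSpace.Completion.isUniformInducing_coe _) _

/-- The bounded operator `b ↦ a ⊗ b` from `F` to `E ⊗ F`. -/
def insertLeft (F : Type v) [NormedAddCommGroup F] [InnerProductSpace ℂ F] (a : E) :
    F →L[ℂ] HilbertTensor E F :=
  (UniformSpace.Completion.toComplL : (E ⊗[ℂ] F) →L[ℂ] HilbertTensor E F) ∘L
    TensorProduct.mkL ℂ E F a

/-- The bounded operator `a ↦ a ⊗ b` from `E` to `E ⊗ F`. -/
def insertRight (E : Type u) [NormedAddCommGroup E] [InnerProductSpace ℂ E] (b : F) :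
    E →L[ℂ] HilbertTensor E F :=
  (UniformSpace.Completion.toComplL : (E ⊗[ℂ] F) →L[ℂ] HilbertTensor E F) ∘L
    (TensorProduct.mkL ℂ E F).flip b

theorem insertLeft_apply (a : E) (b : F) : insertLeft F a b = tmul a b := rfl

theorem insertRight_apply (a : E) (b : F) : insertRight E b a = tmul a b := rfl

end Tensor

section Trace

variable (E : Type u) [NormedAddCommGroup E] [InnerProductSpace ℂ E] [CompleteSpace E]

/-- The index set of a fixed orthonormal (Hilbert) basis of the Hilbert space `E`. -/
def basisSet : Set E := (exists_hilbertBasis ℂ E).choose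

/-- A fixed orthonormal (Hilbert) basis of the Hilbert space `E`. -/
def basis : HilbertBasis (basisSet E) ℂ E := (exists_hilbertBasis ℂ E).choose_spec.choose

variable {E}

/-- A bounded operator `A` is of trace class if `∑ i, ⟪e i, |A| e i⟫ < ∞` for an orthonormal
basis `e`, where `|A| = (A† A) ^ (1/2)`. -/
def IsTraceClass (A : E →L[ℂ] E) : Prop :=
  Summable fun i => (inner ℂ (basis E i) (CFC.abs A (basis E i))).re

/-- The trace `∑ i, ⟪e i, A e i⟫` of a (trace class) operator. -/
def trace (A : E →L[ℂ] E) : ℂ := ∑' i, inner ℂ (basis E i) (A (basis E i))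

/-- Density operators (normal states): positive trace class operators of trace one. -/
structure IsDensityOperator (ρ : E →L[ℂ] E) : Prop where
  isPositive : ρ.IsPositive
  isTraceClass : IsTraceClass ρ
  trace_eq_one : trace ρ = 1

/-- The partial trace over `G` of an operator `T` on `K`, where `V g : E → K` inserts the vector
`g : G` at one place of a tensor product: the operator `∑ i, (V (e i))† T (V (e i))` on `E`, with
`e` an orthonormal basis of `G` (for `T` of trace class the series is absolutely convergent
in norm). -/
def partialTrace {G : Type v} {K : Type w}
    [NormedAddCommGroup G] [InnerProductSpace ℂ G] [CompleteSpace G]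
    [NormedAddCommGroup K] [InnerProductSpace ℂ K] [CompleteSpace K]
    (V : G → (E →L[ℂ] K)) (T : K →L[ℂ] K) : E →L[ℂ] E :=
  ∑' i, (ContinuousLinearMap.adjoint (V (basis G i))) ∘L T ∘L V (basis G i)

end Trace

section Triple

variable {H₁ : Type u} {H₂ : Type v} {H₃ : Type w}
  [NormedAddCommGroup H₁] [InnerProductSpace ℂ H₁] [CompleteSpace H₁]
  [NormedAddCommGroup H₂] [InnerProductSpace ℂ H₂] [CompleteSpace H₂]
  [NormedAddCommGroup H₃] [InnerProductSpace ℂ H₃] [CompleteSpace H₃]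

/-- Partial trace over the first factor of `H₁ ⊗ H₂ ⊗ H₃`. -/
def partialTrace₁ (T : HilbertTensor H₁ (HilbertTensor H₂ H₃) →L[ℂ]
      HilbertTensor H₁ (HilbertTensor H₂ H₃)) :
    HilbertTensor H₂ H₃ →L[ℂ] HilbertTensor H₂ H₃ :=
  partialTrace (fun g : H₁ => insertLeft (HilbertTensor H₂ H₃) g) T

/-- Partial trace over the second factor of `H₁ ⊗ H₂ ⊗ H₃`; the inserting operator is
`a ⊗ c ↦ a ⊗ g ⊗ c`. -/
def partialTrace₂ (T : HilbertTensor H₁ (HilbertTensor H₂ H₃) →L[ℂ]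
      HilbertTensor H₁ (HilbertTensor H₂ H₃)) :
    HilbertTensor H₁ H₃ →L[ℂ] HilbertTensor H₁ H₃ :=
  partialTrace (fun g : H₂ => opTensor (ContinuousLinearMap.id ℂ H₁) (insertLeft H₃ g)) T

/-- Partial trace over the third factor of `H₁ ⊗ H₂ ⊗ H₃`; the inserting operator is
`a ⊗ b ↦ a ⊗ b ⊗ g`. -/
def partialTrace₃ (T : HilbertTensor H₁ (HilbertTensor H₂ H₃) →L[ℂ]
      HilbertTensor H₁ (HilbertTensor H₂ H₃)) :
    HilbertTensor H₁ H₂ →L[ℂ] HilbertTensor H₁ H₂ :=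
  partialTrace (fun g : H₃ => opTensor (ContinuousLinearMap.id ℂ H₁) (insertRight H₂ g)) T

end Triple

/-- A state `ρ` on `H ⊗ H` is a Bell class state if there is a density operator on `H ⊗ H ⊗ H`
whose partial traces over the first, over the second and over the third factor all equal `ρ`. -/
def IsBellClassState {H : Type u} [NormedAddCommGroup H] [InnerProductSpace ℂ H] [CompleteSpace H]
    (ρ : HilbertTensor H H →L[ℂ] HilbertTensor H H) : Prop :=
  IsDensityOperator ρ ∧
    ∃ T : HilbertTensor H (HilbertTensor H H) →L[ℂ] HilbertTensor H (HilbertTensor H H),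
      IsDensityOperator T ∧
        partialTrace₁ T = ρ ∧ partialTrace₂ T = ρ ∧ partialTrace₃ T = ρ

/-- Bounded quantum observables of norm at most one: self-adjoint bounded operators `W` with
`‖W‖ ≤ 1`. -/
def IsUnitObservable {H : Type u} [NormedAddCommGroup H] [InnerProductSpace ℂ H] [CompleteSpace H]
    (W : H →L[ℂ] H) : Prop :=
  IsSelfAdjoint W ∧ ‖W‖ ≤ 1

end BellClass

end

/-! All three correlations are expectations in the single state `T`: placing `A`, `B`, `C` on the
three factors, `A ⊗ B ⊗ 1`, `A ⊗ 1 ⊗ C` and `1 ⊗ B ⊗ C` reduce to pair correlations in `ρ`, because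
every partial trace of `T` is `ρ` (`trace_partialTrace_comp`). The inequality then follows from
positivity of products `(1 ± A) ⊗ (1 ± B) ⊗ (1 ± C)`: adding two with all signs opposite cancels the
terms of odd degree (`bell_expectation`). The analytic work is to justify the traces. With `S = √T`
Hilbert–Schmidt, `hasSum_inner_sq_mul` turns `tr(T X)`, computed in any Hilbert basis, into `∑ ⟪S f,
X S f⟫`, which is visibly linear and positive in `X`. -/

noncomputable section

namespace BellClass

/-! ### Tensor products of bounded operators and their positivity. -/

section TensorLemmas

variable {E F E' F' K : Type*}
  [NormedAddCommGroup E] [InnerProductSpace ℂ E]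
  [NormedAddCommGroup F] [InnerProductSpace ℂ F]
  [NormedAddCommGroup E'] [InnerProductSpace ℂ E']
  [NormedAddCommGroup F'] [InnerProductSpace ℂ F']
  [NormedAddCommGroup K] [InnerProductSpace ℂ K]

theorem inner_tmul_tmul (a a' : E) (b b' : F) :
    inner ℂ (tmul a b) (tmul a' b') = inner ℂ a a' * inner ℂ b b' := by
  rw [tmul, tmul, UniformSpace.Completion.inner_coe, TensorProduct.inner_tmul]

theorem hilbertTensor_induction {p : HilbertTensor E F → Prop}
    (hp : IsClosed {x | p x}) (htmul : ∀ a b, p (tmul a b))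
    (hadd : ∀ x y, p x → p y → p (x + y)) (x : HilbertTensor E F) : p x := by
  refine UniformSpace.Completion.induction_on x hp fun t => ?_
  induction t using TensorProduct.induction_on with
  | zero => simpa [tmul] using htmul 0 0
  | tmul a b => exact htmul a b
  | add s t hs ht =>
    rw [UniformSpace.Completion.coe_add]
    exact hadd _ _ hs ht

theorem hilbertTensor_ext {A B : HilbertTensor E F →L[ℂ] K}
    (h : ∀ a b, A (tmul a b) = B (tmul a b)) : A = B := by
  ext x
  refine hilbertTensor_induction (p := fun x => A x = B x)
    (isClosed_eq A.continuous B.continuous) h (fun x y hx hy => ?_) x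
  rw [map_add, map_add, hx, hy]

theorem eq_zero_of_inner_tmul_eq_zero (z : HilbertTensor E F)
    (h : ∀ a b, inner ℂ (tmul a b) z = 0) : z = 0 := by
  have key : ∀ x, inner ℂ x z = 0 :=
    hilbertTensor_induction (isClosed_eq (by fun_prop) continuous_const) h
      fun x y hx hy => by rw [inner_add_left, hx, hy, add_zero]
  exact inner_self_eq_zero.mp (key z)

theorem tmul_add (a : E) (b b' : F) : tmul a (b + b') = tmul a b + tmul a b' :=
  (insertLeft F a).map_add b b'

theorem tmul_sub (a : E) (b b' : F) : tmul a (b - b') = tmul a b - tmul a b' :=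
  (insertLeft F a).map_sub b b'

theorem add_tmul (a a' : E) (b : F) : tmul (a + a') b = tmul a b + tmul a' b :=
  (insertRight E b).map_add a a'

theorem sub_tmul (a a' : E) (b : F) : tmul (a - a') b = tmul a b - tmul a' b :=
  (insertRight E b).map_sub a a'

theorem opTensor_add_left (A A' : E →L[ℂ] E') (B : F →L[ℂ] F') :
    opTensor (A + A') B = opTensor A B + opTensor A' B :=
  hilbertTensor_ext fun a b => by simp [opTensor_tmul, add_tmul]

theorem opTensor_sub_left (A A' : E →L[ℂ] E') (B : F →L[ℂ] F') :
    opTensor (A - A') B = opTensor A B - opTensor A' B :=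
  hilbertTensor_ext fun a b => by simp [opTensor_tmul, sub_tmul]

theorem opTensor_add_right (A : E →L[ℂ] E') (B B' : F →L[ℂ] F') :
    opTensor A (B + B') = opTensor A B + opTensor A B' :=
  hilbertTensor_ext fun a b => by simp [opTensor_tmul, tmul_add]

theorem opTensor_sub_right (A : E →L[ℂ] E') (B B' : F →L[ℂ] F') :
    opTensor A (B - B') = opTensor A B - opTensor A B' :=
  hilbertTensor_ext fun a b => by simp [opTensor_tmul, tmul_sub]

theorem opTensor_one_one : opTensor (1 : E →L[ℂ] E) (1 : F →L[ℂ] F) = 1 :=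
  hilbertTensor_ext fun a b => by simp [opTensor_tmul]

/-- `M` and `N` play the roles of `A† A'` and `B† B'`; stating them through inner products avoids
adjoints, hence completeness of the factors. -/
theorem inner_opTensor_opTensor {A : E →L[ℂ] E'} {B : F →L[ℂ] F'} {A' : E →L[ℂ] E'}
    {B' : F →L[ℂ] F'} {M : E →L[ℂ] E} {N : F →L[ℂ] F}
    (hA : ∀ x y, inner ℂ (A x) (A' y) = inner ℂ x (M y))
    (hB : ∀ x y, inner ℂ (B x) (B' y) = inner ℂ x (N y)) (x y : HilbertTensor E F) :
    inner ℂ (opTensor A B x) (opTensor A' B' y) = inner ℂ x (opTensor M N y) := by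
  refine hilbertTensor_induction
    (p := fun x => inner ℂ (opTensor A B x) (opTensor A' B' y) = inner ℂ x (opTensor M N y))
    (isClosed_eq (by fun_prop) (by fun_prop)) (fun a b => ?_) (fun x x' hx hx' => ?_) x
  · refine hilbertTensor_induction
      (p := fun y => inner ℂ (opTensor A B (tmul a b)) (opTensor A' B' y)
        = inner ℂ (tmul a b) (opTensor M N y))
      (isClosed_eq (by fun_prop) (by fun_prop)) (fun a' b' => ?_) (fun y y' hy hy' => ?_) y
    · simp only [opTensor_tmul, inner_tmul_tmul, hA, hB]
    · simp only [map_add, inner_add_right, hy, hy']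
  · simp only [map_add, inner_add_left, hx, hx']

/-- If `P = S† S` and `Q = R† R`, then `P ⊗ Q = (S ⊗ R)† (S ⊗ R)`. -/
theorem isPositive_opTensor [CompleteSpace E] [CompleteSpace F] {P : E →L[ℂ] E}
    {Q : F →L[ℂ] F} (hP : 0 ≤ P) (hQ : 0 ≤ Q) : 0 ≤ opTensor P Q := by
  obtain ⟨S, rfl⟩ := CStarAlgebra.nonneg_iff_eq_star_mul_self.mp hP
  obtain ⟨R, rfl⟩ := CStarAlgebra.nonneg_iff_eq_star_mul_self.mp hQ
  have key : star (opTensor S R) * opTensor S R = opTensor (star S * S) (star R * R) := by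
    ext y
    refine ext_inner_left ℂ fun x => ?_
    rw [← inner_opTensor_opTensor (A := S) (B := R) (A' := S) (B' := R)]
    · simp [ContinuousLinearMap.star_eq_adjoint, ContinuousLinearMap.adjoint_inner_right]
    · simp [ContinuousLinearMap.star_eq_adjoint, ContinuousLinearMap.adjoint_inner_right]
    · simp [ContinuousLinearMap.star_eq_adjoint, ContinuousLinearMap.adjoint_inner_right]
  rw [← key]
  exact star_mul_self_nonneg (opTensor S R)

end TensorLemmas

/-! ### Hilbert–Schmidt sums and cyclicity of the trace. -/

section TraceLemmas

variable {ι κ : Type*} {E K : Type*}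
  [NormedAddCommGroup E] [InnerProductSpace ℂ E]
  [NormedAddCommGroup K] [InnerProductSpace ℂ K]

theorem hasSum_norm_sq_inner (e : HilbertBasis ι ℂ E) (x : E) :
    HasSum (fun i => ‖inner ℂ (e i) x‖ ^ 2) (‖x‖ ^ 2) := by
  have h := e.hasSum_inner_mul_inner x x
  rw [inner_self_eq_norm_sq_to_K] at h
  have h' := Complex.hasSum_re h
  convert h' using 1
  · ext i
    rw [← inner_conj_symm x (e i), Complex.conj_mul']
    norm_cast
  · norm_cast

/-- The operator norm is bounded by the Hilbert–Schmidt norm. -/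
theorem norm_sq_le_tsum_norm_sq [CompleteSpace E] [CompleteSpace K] (e : HilbertBasis ι ℂ E)
    (A : E →L[ℂ] K)
    (hA : Summable fun i => ‖A (e i)‖ ^ 2) : ‖A‖ ^ 2 ≤ ∑' i, ‖A (e i)‖ ^ 2 := by
  have h0 : 0 ≤ ∑' i, ‖A (e i)‖ ^ 2 := tsum_nonneg fun i => by positivity
  -- For the adjoint, Parseval gives `‖A† y‖² = ∑ |⟪A eᵢ, y⟫|²`, and Cauchy–Schwarz applies
  -- termwise.
  rw [← LinearIsometryEquiv.norm_map ContinuousLinearMap.adjoint A]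
  refine (Real.le_sqrt (norm_nonneg _) h0).mp ?_
  refine ContinuousLinearMap.opNorm_le_bound _ (Real.sqrt_nonneg _) fun y => ?_
  refine abs_le_of_sq_le_sq' ?_ (by positivity) |>.2
  rw [mul_pow, Real.sq_sqrt h0, ← (hasSum_norm_sq_inner e _).tsum_eq, ← tsum_mul_right]
  refine (hasSum_norm_sq_inner e _).summable.tsum_le_tsum (fun i => ?_) (hA.mul_right _)
  rw [ContinuousLinearMap.adjoint_inner_right, ← mul_pow]
  gcongr
  exact norm_inner_le_norm _ _

theorem summable_inner_apply {S : κ → K} (hS : Summable fun j => ‖S j‖ ^ 2) (X : K →L[ℂ] K) :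
    Summable fun j => inner ℂ (S j) (X (S j)) := by
  refine Summable.of_norm_bounded (hS.mul_left ‖X‖) fun j => ?_
  calc ‖inner ℂ (S j) (X (S j))‖ ≤ ‖S j‖ * (‖X‖ * ‖S j‖) :=
        (norm_inner_le_norm _ _).trans (by gcongr; exact X.le_opNorm _)
    _ = ‖X‖ * ‖S j‖ ^ 2 := by ring

/-- Cyclicity of the trace: for a self-adjoint Hilbert–Schmidt operator `S`, the trace of
`S ^ 2 * X` may be computed as the trace of `S * X * S`, and in any pair of Hilbert bases. -/
theorem hasSum_inner_sq_mul [CompleteSpace K] (f : HilbertBasis κ ℂ K) {S : K →L[ℂ] K}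
    (hS : IsSelfAdjoint S) (hf : Summable fun j => ‖S (f j)‖ ^ 2) (X : K →L[ℂ] K) (e : HilbertBasis ι ℂ K) :
    HasSum (fun i => inner ℂ (e i) ((S * S * X) (e i)))
      (∑' j, inner ℂ (S (f j)) (X (S (f j)))) := by
  have hsym : ∀ x y, inner ℂ (S x) y = inner ℂ x (S y) := fun x y => by
    rw [← ContinuousLinearMap.adjoint_inner_right, ← ContinuousLinearMap.star_eq_adjoint,
      hS.star_eq]
  -- Both factors are square summable over `κ × ι`, so `a` is absolutely summable; its column and
  -- row sums, found by Parseval, are the two sides.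
  let a : κ × ι → ℂ := fun p => inner ℂ (S (e p.2)) (f p.1) * inner ℂ (f p.1) (S (X (e p.2)))
  have ha : Summable a := by
    have hb (x : κ → K) (c : ℝ) (hx : ∀ j, ‖x j‖ ≤ c * ‖S (f j)‖) :
        Summable fun p : κ × ι => ‖inner ℂ (e p.2) (x p.1)‖ ^ 2 := by
      rw [summable_prod_of_nonneg fun p => by positivity]
      refine ⟨fun j => (hasSum_norm_sq_inner e (x j)).summable, ?_⟩
      simp only [(hasSum_norm_sq_inner e _).tsum_eq]
      refine Summable.of_nonneg_of_le (fun j => by positivity) (fun j => ?_) (hf.mul_left (c ^ 2))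
      rw [← mul_pow]
      exact pow_le_pow_left₀ (norm_nonneg _) (hx j) 2
    have h1 := hb (fun j => S (f j)) 1 fun j => (one_mul _).ge
    have h2 := hb (fun j => ContinuousLinearMap.adjoint X (S (f j)))
      ‖ContinuousLinearMap.adjoint X‖ fun j => ContinuousLinearMap.le_opNorm _ _
    refine Summable.of_norm_bounded (h1.add h2) fun p => ?_
    have e1 : ‖inner ℂ (S (e p.2)) (f p.1)‖ = ‖inner ℂ (e p.2) (S (f p.1))‖ := by rw [hsym]
    have e2 : ‖inner ℂ (f p.1) (S (X (e p.2)))‖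
        = ‖inner ℂ (e p.2) (ContinuousLinearMap.adjoint X (S (f p.1)))‖ := by
      rw [ContinuousLinearMap.adjoint_inner_right, ← hsym, norm_inner_symm]
    rw [norm_mul, e1, e2]
    nlinarith [two_mul_le_add_sq ‖inner ℂ (e p.2) (S (f p.1))‖
      ‖inner ℂ (e p.2) (ContinuousLinearMap.adjoint X (S (f p.1)))‖,
      sq_nonneg ‖inner ℂ (e p.2) (S (f p.1))‖,
      sq_nonneg ‖inner ℂ (e p.2) (ContinuousLinearMap.adjoint X (S (f p.1)))‖]
  have hcol (i : ι) : HasSum (fun j => a (j, i)) (inner ℂ (e i) ((S * S * X) (e i))) := by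
    have := f.hasSum_inner_mul_inner (S (e i)) (S (X (e i)))
    rwa [hsym] at this
  have hrow (j : κ) : HasSum (fun i => a (j, i)) (inner ℂ (S (f j)) (X (S (f j)))) := by
    have := e.hasSum_inner_mul_inner (ContinuousLinearMap.adjoint X (S (f j))) (S (f j))
    rw [ContinuousLinearMap.adjoint_inner_left] at this
    refine this.congr_fun fun i => ?_
    simp only [a]
    rw [hsym, ContinuousLinearMap.adjoint_inner_left, ← hsym (f j), mul_comm]
  have htot := ha.hasSum
  rw [← (htot.prod_fiberwise hrow).tsum_eq] at htot
  exact ((Equiv.prodComm ι κ).hasSum_iff.mpr htot).prod_fiberwise hcol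

end TraceLemmas

end BellClass

namespace BellClass

/-! ### The trace against a partial trace as an expectation. -/

section PartialTrace

universe u v w

variable {E : Type u} {G : Type v} {K : Type w}
  [NormedAddCommGroup E] [InnerProductSpace ℂ E] [CompleteSpace E]
  [NormedAddCommGroup G] [InnerProductSpace ℂ G]
  [NormedAddCommGroup K] [InnerProductSpace ℂ K] [CompleteSpace K]

/-- Inserting Hilbert basis vectors of both factors gives a Hilbert basis. -/
theorem exists_hilbertBasis_insert {ι κ : Type*} (e : HilbertBasis ι ℂ G)
    (b : HilbertBasis κ ℂ E) (V : G → (E →L[ℂ] K))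
    (hV : ∀ g g' x y, inner ℂ (V g x) (V g' y) = inner ℂ g g' * inner ℂ x y)
    (htot : ∀ z, (∀ i x, inner ℂ (V (e i) x) z = 0) → z = 0) :
    ∃ B : HilbertBasis (κ × ι) ℂ K, ∀ p, B p = V (e p.2) (b p.1) := by
  classical
  have ho : Orthonormal ℂ fun p : κ × ι => V (e p.2) (b p.1) := by
    rw [orthonormal_iff_ite]
    rintro ⟨k, i⟩ ⟨k', i'⟩
    rw [hV, orthonormal_iff_ite.mp e.orthonormal, orthonormal_iff_ite.mp b.orthonormal]
    by_cases h : k = k' <;> by_cases h' : i = i' <;> simp [h, h']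
  refine ⟨HilbertBasis.mkOfOrthogonalEqBot ho ?_, fun p =>
    congrFun (HilbertBasis.coe_mkOfOrthogonalEqBot ho _) p⟩
  rw [Submodule.eq_bot_iff]
  intro z hz
  refine htot z fun i x => ?_
  have h0 : ContinuousLinearMap.adjoint (V (e i)) z = 0 := by
    refine b.repr.injective (lp.ext (funext fun k => ?_))
    rw [b.repr_apply_apply, ContinuousLinearMap.adjoint_inner_right, map_zero]
    exact (Submodule.mem_orthogonal _ _).mp hz _ (Submodule.subset_span ⟨(k, i), rfl⟩)
  rw [← ContinuousLinearMap.adjoint_inner_right, h0, inner_zero_right]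

theorem inner_self_sq_apply {S : K →L[ℂ] K} (hS : IsSelfAdjoint S) (z : K) :
    inner ℂ z ((S * S) z) = ((‖S z‖ ^ 2 : ℝ) : ℂ) := by
  rw [mul_apply_eq_comp]
  nth_rewrite 1 [← hS.star_eq]
  rw [ContinuousLinearMap.star_eq_adjoint, ContinuousLinearMap.adjoint_inner_right,
    inner_self_eq_norm_sq_to_K]
  norm_cast

/-- Since `|T| = T` and `⟪f, T f⟫ = ‖√T f‖²`, the trace conditions say that `√T` has Hilbert–Schmidt
norm one. -/
theorem hasSum_norm_sq_sqrt {T : K →L[ℂ] K} (hT : IsDensityOperator T) :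
    HasSum (fun j => ‖CFC.sqrt T (basis K j)‖ ^ 2) 1 := by
  have h0 : 0 ≤ T := (ContinuousLinearMap.nonneg_iff_isPositive T).mpr hT.isPositive
  have hsa : IsSelfAdjoint (CFC.sqrt T) := (CFC.sqrt_nonneg T).isSelfAdjoint
  have key (j) : inner ℂ (basis K j) (T (basis K j))
      = ((‖CFC.sqrt T (basis K j)‖ ^ 2 : ℝ) : ℂ) := by
    rw [← inner_self_sq_apply hsa, CFC.sqrt_mul_sqrt_self T h0]
  have hs := hT.isTraceClass
  rw [IsTraceClass, CFC.abs_of_nonneg T h0] at hs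
  simp only [key, Complex.ofReal_re] at hs
  have ht := hT.trace_eq_one
  simp only [trace, key] at ht
  rw [← Complex.ofReal_tsum] at ht
  have := hs.hasSum
  rwa [show ∑' j, ‖CFC.sqrt T (basis K j)‖ ^ 2 = 1 from mod_cast ht] at this

/-- The expectation of the observable `Y` in the state `T`. -/
def expectation (T Y : K →L[ℂ] K) : ℂ :=
  ∑' j, inner ℂ (CFC.sqrt T (basis K j)) (Y (CFC.sqrt T (basis K j)))

section Expectation

variable {T : K →L[ℂ] K}

theorem expectation_one (hT : IsDensityOperator T) : expectation T 1 = 1 := by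
  have h' := Complex.hasSum_ofReal.mpr (hasSum_norm_sq_sqrt hT)
  rw [Complex.ofReal_one] at h'
  rw [expectation, ← h'.tsum_eq]
  refine tsum_congr fun j => ?_
  rw [one_apply_eq_self, inner_self_eq_norm_sq_to_K]
  norm_cast

theorem expectation_add (hT : IsDensityOperator T) (X Y : K →L[ℂ] K) :
    expectation T (X + Y) = expectation T X + expectation T Y := by
  have h := (hasSum_norm_sq_sqrt hT).summable
  simp only [expectation, add_apply, inner_add_right]
  exact (summable_inner_apply h X).tsum_add (summable_inner_apply h Y)

theorem expectation_sub (hT : IsDensityOperator T) (X Y : K →L[ℂ] K) :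
    expectation T (X - Y) = expectation T X - expectation T Y := by
  have h := (hasSum_norm_sq_sqrt hT).summable
  simp only [expectation, sub_apply, inner_sub_right]
  exact (summable_inner_apply h X).tsum_sub (summable_inner_apply h Y)

end Expectation

theorem expectation_nonneg (T : K →L[ℂ] K) {Y : K →L[ℂ] K} (hY : 0 ≤ Y) :
    0 ≤ expectation T Y :=
  tsum_nonneg fun _ =>
    ((ContinuousLinearMap.nonneg_iff_isPositive Y).mp hY).inner_nonneg_right _

/-- If `V g` inserts the vector `g` and intertwines `X` with `X'`, then the trace of `X` against
the partial trace of `T` is the expectation of `X'` in the state `T`. -/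
theorem trace_partialTrace_comp [CompleteSpace G] {T : K →L[ℂ] K} (hT : IsDensityOperator T)
    (V : G → (E →L[ℂ] K))
    (hV : ∀ g g' x y, inner ℂ (V g x) (V g' y) = inner ℂ g g' * inner ℂ x y)
    (htot : ∀ z, (∀ i x, inner ℂ (V (basis G i) x) z = 0) → z = 0)
    {X : E →L[ℂ] E} {X' : K →L[ℂ] K} (hX : ∀ g x, V g (X x) = X' (V g x)) :
    trace (partialTrace V T ∘L X) = expectation T X' := by
  set S := CFC.sqrt T with hSdef
  have hSS : S * S = T := CFC.sqrt_mul_sqrt_self T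
    ((ContinuousLinearMap.nonneg_iff_isPositive T).mpr hT.isPositive)
  have hsa : IsSelfAdjoint S := (CFC.sqrt_nonneg T).isSelfAdjoint
  have hf := (hasSum_norm_sq_sqrt hT).summable
  obtain ⟨B, hB⟩ := exists_hilbertBasis_insert (basis G) (basis E) V hV htot
  -- Cyclicity with `X = 1` carries the Hilbert–Schmidt property from the fixed basis to `B`.
  have hSB : Summable fun p => ‖S (B p)‖ ^ 2 := by
    have := (hasSum_inner_sq_mul (basis K) hsa hf 1 B).summable
    simp only [mul_one, inner_self_sq_apply hsa] at this
    exact Complex.summable_ofReal.mp this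
  have hSB' := (summable_prod_of_nonneg fun p => sq_nonneg _).mp
    ((Equiv.prodComm _ _).summable_iff.mpr hSB)
  -- Without summability the `tsum` in `partialTrace` would take its default value. Each term has
  -- norm `‖S V(eᵢ)‖²`, at most a fibre sum of `‖S B‖²`.
  have hsum : Summable fun i =>
      ContinuousLinearMap.adjoint (V (basis G i)) ∘L T ∘L V (basis G i) := by
    refine Summable.of_norm_bounded hSB'.2 fun i => ?_
    have h1 : ContinuousLinearMap.adjoint (V (basis G i)) ∘L T ∘L V (basis G i)
        = ContinuousLinearMap.adjoint (S ∘L V (basis G i)) ∘L (S ∘L V (basis G i)) := by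
      rw [ContinuousLinearMap.adjoint_comp, ← ContinuousLinearMap.star_eq_adjoint S, hsa.star_eq,
        ← hSS]
      rfl
    rw [h1, ContinuousLinearMap.norm_adjoint_comp_self, ← sq]
    have h2 := hSB'.1 i
    simp only [Equiv.prodComm_apply, Prod.swap_prod_mk, hB] at h2 ⊢
    exact norm_sq_le_tsum_norm_sq (basis E) (S ∘L V (basis G i)) h2
  have htotal := hasSum_inner_sq_mul (basis K) hsa hf X' B
  rw [hSS] at htotal
  -- Intertwining moves `X` past the insertion, so grouping the trace of `T X'` by the basis of `E`
  -- yields the diagonal of the partial trace times `X`.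
  have hfib (k) : HasSum (fun i => inner ℂ (B (k, i)) ((T * X') (B (k, i))))
      (inner ℂ (basis E k) ((partialTrace V T ∘L X) (basis E k))) := by
    have h := (hsum.hasSum.mapL (ContinuousLinearMap.apply ℂ E (X (basis E k)))).mapL
      (innerSL ℂ (basis E k))
    refine h.congr_fun fun i => ?_
    simp [hB, ContinuousLinearMap.adjoint_inner_right, hX]
  exact (htotal.prod_fiberwise hfib).tsum_eq

end PartialTrace

end BellClass

namespace BellClass

/-! ### The three marginals of a state on the triple product. -/

section Triple

variable {H : Type*} [NormedAddCommGroup H] [InnerProductSpace ℂ H]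

theorem inner_opTensor_id {E F F' : Type*} [NormedAddCommGroup E] [InnerProductSpace ℂ E]
    [NormedAddCommGroup F] [InnerProductSpace ℂ F]
    [NormedAddCommGroup F'] [InnerProductSpace ℂ F'] {B B' : F →L[ℂ] F'} {c : ℂ}
    (hB : ∀ x y, inner ℂ (B x) (B' y) = c * inner ℂ x y) (x y : HilbertTensor E F) :
    inner ℂ (opTensor (ContinuousLinearMap.id ℂ E) B x)
      (opTensor (ContinuousLinearMap.id ℂ E) B' y) = c * inner ℂ x y := by
  have hc : opTensor (ContinuousLinearMap.id ℂ E) (c • ContinuousLinearMap.id ℂ F)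
      = c • ContinuousLinearMap.id ℂ (HilbertTensor E F) :=
    hilbertTensor_ext fun a b => by
      rw [opTensor_tmul]
      exact (insertLeft F a).map_smul c b
  rw [inner_opTensor_opTensor (M := ContinuousLinearMap.id ℂ E)
    (N := c • ContinuousLinearMap.id ℂ F), hc]
  · simp [inner_smul_right]
  · simp
  · simp [hB]

/-- Totality in `trace_partialTrace_comp` tests only inserted basis vectors; continuity extends it
to all vectors. -/
theorem eq_zero_of_inner_hilbertBasis {ι E K : Type*} [NormedAddCommGroup E]
    [InnerProductSpace ℂ E] [NormedAddCommGroup K] [InnerProductSpace ℂ K]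
    (b : HilbertBasis ι ℂ E) (A : E →L[ℂ] K) (z : K)
    (h : ∀ i, inner ℂ (A (b i)) z = 0) (x : E) : inner ℂ (A x) z = 0 := by
  have h1 := ((b.hasSum_repr x).mapL A).mapL (innerSL ℂ z)
  have h2 : ∀ i, innerSL ℂ z (A (b.repr x i • b i)) = 0 := fun i => by
    rw [map_smul, map_smul, innerSL_apply_apply, inner_eq_zero_symm.mp (h i), smul_zero]
  simp only [h2] at h1
  exact inner_eq_zero_symm.mp (h1.unique hasSum_zero)

theorem eq_zero_of_inner_tmul_tmul {E F G : Type*} [NormedAddCommGroup E] [InnerProductSpace ℂ E]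
    [NormedAddCommGroup F] [InnerProductSpace ℂ F] [NormedAddCommGroup G] [InnerProductSpace ℂ G]
    (z : HilbertTensor E (HilbertTensor F G))
    (h : ∀ a b c, inner ℂ (tmul a (tmul b c)) z = 0) : z = 0 := by
  refine eq_zero_of_inner_tmul_eq_zero z fun a y => ?_
  refine hilbertTensor_induction (p := fun y => inner ℂ (tmul a y) z = 0)
    (isClosed_eq ?_ continuous_const) (h a) (fun x y hx hy => ?_) y
  · exact (insertLeft _ a).continuous.inner continuous_const
  · rw [tmul_add, inner_add_left, hx, hy, add_zero]

variable [CompleteSpace H]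
  {T : HilbertTensor H (HilbertTensor H H) →L[ℂ] HilbertTensor H (HilbertTensor H H)}

theorem trace_partialTrace₁_comp (hT : IsDensityOperator T) (A B : H →L[ℂ] H) :
    trace (partialTrace₁ T ∘L opTensor A B) = expectation T (opTensor 1 (opTensor A B)) := by
  refine trace_partialTrace_comp hT _ (fun g g' x y => ?_)
    (fun z hz => eq_zero_of_inner_tmul_eq_zero z fun a y => ?_) fun g x => ?_
  · rw [insertLeft_apply, insertLeft_apply, inner_tmul_tmul]
  · refine eq_zero_of_inner_hilbertBasis (basis H) (insertRight H y) z (fun i => ?_) a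
    rw [insertRight_apply, ← insertLeft_apply]
    exact hz i y
  · rw [insertLeft_apply, insertLeft_apply, opTensor_tmul, one_apply_eq_self]

theorem trace_partialTrace₂_comp (hT : IsDensityOperator T) (A B : H →L[ℂ] H) :
    trace (partialTrace₂ T ∘L opTensor A B) = expectation T (opTensor A (opTensor 1 B)) := by
  refine trace_partialTrace_comp hT _
    (fun g g' x y => inner_opTensor_id (fun x y => inner_tmul_tmul g g' x y) x y)
    (fun z hz => eq_zero_of_inner_tmul_tmul z fun a b c => ?_) fun g x => ?_
  · refine eq_zero_of_inner_hilbertBasis (basis H) (insertLeft _ a ∘L insertRight H c) z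
      (fun i => ?_) b
    have h := hz i (tmul a c)
    rw [opTensor_tmul] at h
    exact h
  · rw [← ContinuousLinearMap.comp_apply, ← ContinuousLinearMap.comp_apply]
    congr 1
    exact hilbertTensor_ext fun a b => by simp [opTensor_tmul, insertLeft_apply]

theorem trace_partialTrace₃_comp (hT : IsDensityOperator T) (A B : H →L[ℂ] H) :
    trace (partialTrace₃ T ∘L opTensor A B) = expectation T (opTensor A (opTensor B 1)) := by
  refine trace_partialTrace_comp hT _
    (fun g g' x y => inner_opTensor_id (fun x y => ?_) x y)
    (fun z hz => eq_zero_of_inner_tmul_tmul z fun a b c => ?_) fun g x => ?_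
  · rw [insertRight_apply, insertRight_apply, inner_tmul_tmul, mul_comm]
  · refine eq_zero_of_inner_hilbertBasis (basis H) (insertLeft _ a ∘L insertLeft H b) z
      (fun i => ?_) c
    have h := hz i (tmul a b)
    rw [opTensor_tmul] at h
    exact h
  · rw [← ContinuousLinearMap.comp_apply, ← ContinuousLinearMap.comp_apply]
    congr 1
    exact hilbertTensor_ext fun a b => by simp [opTensor_tmul, insertRight_apply]

end Triple

/-! ### The Bell inequality from positivity. -/

section Observables

variable {H : Type*} [NormedAddCommGroup H] [InnerProductSpace ℂ H] [CompleteSpace H]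

theorem IsUnitObservable.le_one {W : H →L[ℂ] H} (hW : IsUnitObservable W) : W ≤ 1 := by
  refine (IsSelfAdjoint.le_algebraMap_norm_self (a := W) hW.1).trans ?_
  rw [← map_one (algebraMap ℝ (H →L[ℂ] H))]
  exact algebraMap_mono _ hW.2

theorem IsUnitObservable.neg {W : H →L[ℂ] H} (hW : IsUnitObservable W) :
    IsUnitObservable (-W) :=
  ⟨IsSelfAdjoint.neg hW.1, by rw [norm_neg]; exact hW.2⟩

theorem IsUnitObservable.one_sub_nonneg {W : H →L[ℂ] H} (hW : IsUnitObservable W) :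
    0 ≤ 1 - W :=
  sub_nonneg.mpr hW.le_one

theorem IsUnitObservable.one_add_nonneg {W : H →L[ℂ] H} (hW : IsUnitObservable W) :
    0 ≤ 1 + W := by
  simpa using hW.neg.one_sub_nonneg

/-- The order on `ℂ` makes `c - d` and `c + d` real, hence `c` and `d` too, and the claim is `|d| ≤
c` over `ℝ`. -/
theorem norm_le_of_sub_nonneg_of_add_nonneg {c d : ℂ} (h₁ : 0 ≤ c - d) (h₂ : 0 ≤ c + d) :
    ((‖d‖ : ℝ) : ℂ) ≤ c := by
  rw [Complex.le_def] at h₁ h₂ ⊢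
  simp only [Complex.zero_re, Complex.zero_im, Complex.sub_re, Complex.sub_im, Complex.add_re,
    Complex.add_im, Complex.ofReal_re, Complex.ofReal_im] at h₁ h₂ ⊢
  have hd : d = (d.re : ℂ) := Complex.ext (by simp) (by simp; linarith)
  refine ⟨?_, by linarith⟩
  rw [hd, Complex.norm_real, Real.norm_eq_abs, abs_le]
  constructor <;> linarith

/-- Observables of norm at most one acting on three different tensor factors satisfy the original
Bell inequality in any state. -/
theorem bell_expectation
    {T : HilbertTensor H (HilbertTensor H H) →L[ℂ] HilbertTensor H (HilbertTensor H H)}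
    (hT : IsDensityOperator T) {A B C : H →L[ℂ] H}
    (hA : IsUnitObservable A) (hB : IsUnitObservable B) (hC : IsUnitObservable C) :
    ((‖expectation T (opTensor A (opTensor B 1)) - expectation T (opTensor A (opTensor 1 C))‖ : ℝ)
      : ℂ) ≤ 1 - expectation T (opTensor 1 (opTensor B C)) ∧
    ((‖expectation T (opTensor A (opTensor 1 C)) - expectation T (opTensor 1 (opTensor B C))‖ : ℝ)
      : ℂ) ≤ 1 - expectation T (opTensor A (opTensor B 1)) := by
  have key {P Q R : H →L[ℂ] H} (hP : 0 ≤ P) (hQ : 0 ≤ Q) (hR : 0 ≤ R) :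
      0 ≤ expectation T (opTensor P (opTensor Q R)) :=
    expectation_nonneg T (isPositive_opTensor hP (isPositive_opTensor hQ hR))
  have h₁ := key hA.one_add_nonneg hB.one_add_nonneg hC.one_sub_nonneg
  have h₂ := key hA.one_add_nonneg hB.one_sub_nonneg hC.one_add_nonneg
  have h₃ := key hA.one_sub_nonneg hB.one_add_nonneg hC.one_add_nonneg
  have h₄ := key hA.one_add_nonneg hB.one_sub_nonneg hC.one_sub_nonneg
  have h₅ := key hA.one_sub_nonneg hB.one_sub_nonneg hC.one_add_nonneg
  have h₆ := key hA.one_sub_nonneg hB.one_add_nonneg hC.one_sub_nonneg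
  simp only [opTensor_add_left, opTensor_sub_left, opTensor_add_right, opTensor_sub_right,
    opTensor_one_one, expectation_add hT, expectation_sub hT, expectation_one hT]
    at h₁ h₂ h₃ h₄ h₅ h₆
  -- For instance, `h₂` and `h₆` average to `1 - AB + AC - BC`, which serves both inequalities.
  have half {z w : ℂ} (hz : 0 ≤ z) (hw : 0 ≤ w) : 0 ≤ (z + w) / 2 :=
    div_nonneg (add_nonneg hz hw) zero_le_two
  constructor
  · refine norm_le_of_sub_nonneg_of_add_nonneg ?_ ?_
    · convert half h₂ h₆ using 1
      ring
    · convert half h₁ h₅ using 1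
      ring
  · refine norm_le_of_sub_nonneg_of_add_nonneg ?_ ?_
    · convert half h₄ h₃ using 1
      ring
    · convert half h₂ h₆ using 1
      ring

end Observables

end BellClass

end

/- The inequalities are between complex numbers: `z ≤ w` means that `w - z` is real and
nonnegative, so they include that the right-hand sides are real. -/
theorem theorem3 {H : Type*} [NormedAddCommGroup H] [InnerProductSpace ℂ H] [CompleteSpace H]
    (ρ : BellClass.HilbertTensor H H →L[ℂ] BellClass.HilbertTensor H H)
    (hρ : BellClass.IsBellClassState ρ) :
    (∀ W₁ W₂ W₂' : H →L[ℂ] H,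
      BellClass.IsUnitObservable W₁ → BellClass.IsUnitObservable W₂ →
      BellClass.IsUnitObservable W₂' →
      ((‖BellClass.trace (ρ ∘L BellClass.opTensor W₁ W₂)
          - BellClass.trace (ρ ∘L BellClass.opTensor W₁ W₂')‖ : ℝ) : ℂ)
        ≤ 1 - BellClass.trace (ρ ∘L BellClass.opTensor W₂ W₂')) ∧
    (∀ W₁ W₁' W₂ : H →L[ℂ] H,
      BellClass.IsUnitObservable W₁ → BellClass.IsUnitObservable W₁' →
      BellClass.IsUnitObservable W₂ →
      ((‖BellClass.trace (ρ ∘L BellClass.opTensor W₁ W₂)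
          - BellClass.trace (ρ ∘L BellClass.opTensor W₁' W₂)‖ : ℝ) : ℂ)
        ≤ 1 - BellClass.trace (ρ ∘L BellClass.opTensor W₁ W₁')) := by
  obtain ⟨-, T, hT, h₁, h₂, h₃⟩ := hρ
  have t₁ A B := h₁ ▸ BellClass.trace_partialTrace₁_comp hT A B
  have t₂ A B := h₂ ▸ BellClass.trace_partialTrace₂_comp hT A B
  have t₃ A B := h₃ ▸ BellClass.trace_partialTrace₃_comp hT A B
  refine ⟨fun W₁ W₂ W₂' hW₁ hW₂ hW₂' => ?_, fun W₁ W₁' W₂ hW₁ hW₁' hW₂ => ?_⟩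
  -- The factors carry `W₁, W₂, W₂'` here and `W₁, W₁', W₂` in the second case; each correlation
  -- uses the marginal that traces out the idle factor.
  · rw [t₃ W₁ W₂, t₂ W₁ W₂', t₁ W₂ W₂']
    exact (BellClass.bell_expectation hT hW₁ hW₂ hW₂').1
  · rw [t₂ W₁ W₂, t₁ W₁' W₂, t₃ W₁ W₁']
    exact (BellClass.bell_expectation hT hW₁ hW₁' hW₂).2
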